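/- **Theorem 3 (centralized converse).** Let $K,N,T\ge 1$ be integers. Consider $K$ users who want to run a computation on a dataset of $N$ files $w_1,\dots,w_N$ (bit strings of a common length): user $k$ has an input $d_k$, known to all users, and has to compute $\phi(d_k;w_1,\dots,w_N)=h(v_{k,1},\dots,v_{k,N})$ from the $T$-bit intermediate values $v_{k,n}=g_n(d_k;w_n)\in\{0,1\}^T$, where $g_n$ are Map functions and $h$ is a Reduce function. The Map functions put no constraint on the intermediate values, i.e. the $KN$ values $(v_{k,n})$ can take arbitrary values in $\{0,1\}^T$ simultaneously as the dataset varies. Let $\frac1K\le\mu\le 1$. A dataset placement lets user $k$ store the files with indices in a set $\mathcal U_k\subseteq\{1,\dots,N\}$ with $|\mathcal U_k|\le\mu N$. In an uplink scheme, user $k$ sends to an access point a message $W_k$ of $\ell_k$ bits, which is a function of its local intermediate values $\{v_{q,n}: 1\le q\le K,\ n\in\mathcal U_k\}$. In a downlink scheme, the access point, which does not have the dataset, broadcasts a message $X=\rho(W_1,\dots,W_K)$ of $\ell$ bits to all users. The computation is accomplished if, for every dataset, each user $k$ can determine $v_{k,1},\dots,v_{k,N}$ from $X$ and its local intermediate values.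 The uplink and downlink loads are $$L_u=\frac{\ell_1+\dots+\ell_K}{NT},\qquad L_d=\frac{\ell}{NT}.$$ Then, for any dataset placement and any uplink and downlink schemes that accomplish the computation, $$L_u\ \ge\ L_u^{\mathrm{coded}}(\mu)\qquad\text{and}\qquad L_d\ \ge\ L_d^{\mathrm{coded}}(\mu),$$ where $L_u^{\mathrm{coded}}$ is the lower convex envelope of the points $\bigl(t,\ \frac1t-1\bigr)$, $t\in\{\frac1K,\frac2K,\dots,1\}$, and $L_d^{\mathrm{coded}}$ is the lower convex envelope of the points $\bigl(t,\ \frac{tK}{tK+1}(\frac1t-1)\bigr)$, $t\in\{\frac1K,\frac2K,\dots,1\}$. -/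

import Mathlib

namespace WirelessComputing

/-- Strings of `n` bits, i.e. the underlying set of the field with `2 ^ n` elements (the field
structure plays no role; for `n = 0` there is only the empty string). -/
abbrev Bits (n : ℕ) : Type := Fin n → ZMod 2

/-- A computing application with `K` users, a dataset of `N` files and intermediate values of
`T` bits: every user `k` has an input `d k` and has to compute `φ (d k) w` for the dataset
`w = (w_1, …, w_N)`, where the output function `φ` is decomposed into Map functions `g n` and a
Reduce function `h`. -/
structure Application (K N T : ℕ) where
  /-- number of bits of an input -/
  D : ℕ
  /-- number of bits of a file -/
  F : ℕ
  /-- number of bits of an output -/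
  B : ℕ
  /-- the input of each user, known to all users -/
  d : Fin K → Bits D
  /-- the output function -/
  φ : Bits D → (Fin N → Bits F) → Bits B
  /-- the Map functions -/
  g : Fin N → Bits D → Bits F → Bits T
  /-- the Reduce function -/
  h : (Fin N → Bits T) → Bits B
  /-- the Map-Reduce decomposition of the output function -/
  decomp : ∀ (x : Bits D) (w : Fin N → Bits F), φ x w = h (fun n => g n x (w n))

namespace Application

variable {K N T : ℕ}

/-- The intermediate value `v_{k,n} = g_n(d_k; w_n)` for the input of user `k` and the `n`-th
file of the dataset `w`. -/
def value (A : Application K N T) (w : Fin N → Bits A.F) (k : Fin K) (n : Fin N) : Bits T :=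
  A.g n (A.d k) (w n)

/-- The application puts no constraint on the intermediate values: all `K * N` of them can take
arbitrary values in `Bits T` simultaneously, as the dataset varies. -/
def Unconstrained (A : Application K N T) : Prop :=
  ∀ v : Fin K → Fin N → Bits T, ∃ w : Fin N → Bits A.F, A.value w = v

end Application

/-- A dataset placement together with an uplink and a downlink communication scheme. -/
structure Scheme (K N T : ℕ) where
  /-- the (indices of the) files stored by each user -/
  U : Fin K → Finset (Fin N)
  /-- number of bits of the uplink message of each user -/
  upLen : Fin K → ℕ
  /-- user `k` maps its locally computed intermediate values `v_{q,n}` (all inputs `q`, all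
  stored files `n`) to its uplink message -/
  ψ : (k : Fin K) → (Fin K → {n // n ∈ U k} → Bits T) → Bits (upLen k)
  /-- number of bits of the downlink message -/
  downLen : ℕ
  /-- the access point maps the uplink messages to the downlink message, which is broadcast -/
  ρ : ((k : Fin K) → Bits (upLen k)) → Bits downLen
  /-- user `k` maps its locally computed intermediate values and the downlink message to the
  arguments of the Reduce function for its own input -/
  dec : (k : Fin K) → (Fin K → {n // n ∈ U k} → Bits T) → Bits downLen → Fin N → Bits T

namespace Scheme

variable {K N T : ℕ}

/-- The intermediate values computed by user `k` in the Map phase. -/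
def localValues (S : Scheme K N T) (v : Fin K → Fin N → Bits T) (k : Fin K) :
    Fin K → {n // n ∈ S.U k} → Bits T :=
  fun q n => v q n

/-- The uplink message `W_k`. -/
def uplink (S : Scheme K N T) (v : Fin K → Fin N → Bits T) (k : Fin K) : Bits (S.upLen k) :=
  S.ψ k (S.localValues v k)

/-- The downlink message `X`. -/
def downlink (S : Scheme K N T) (v : Fin K → Fin N → Bits T) : Bits S.downLen :=
  S.ρ (S.uplink v)

/-- The arguments of the Reduce function constructed by user `k`. -/
def recovered (S : Scheme K N T) (v : Fin K → Fin N → Bits T) (k : Fin K) : Fin N → Bits T :=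
  S.dec k (S.localValues v k) (S.downlink v)

/-- The scheme accomplishes the distributed computing for the application `A`: for every dataset,
every user obtains all intermediate values of its own input, which are the arguments of the Reduce
function. -/
def Accomplishes (S : Scheme K N T) (A : Application K N T) : Prop :=
  ∀ (w : Fin N → Bits A.F) (k : Fin K), S.recovered (A.value w) k = A.value w k

/-- If a scheme accomplishes the distributed computing, then every user computes its output. -/
theorem Accomplishes.output_eq {S : Scheme K N T} {A : Application K N T} (hS : S.Accomplishes A)
    (w : Fin N → Bits A.F) (k : Fin K) :
    A.h (S.recovered (A.value w) k) = A.φ (A.d k) w := by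
  rw [hS w k, A.decomp]
  rfl

/-- Every user stores at most a fraction `μ` of the `N` files. -/
def FitsStorage (S : Scheme K N T) (μ : ℝ) : Prop :=
  ∀ k : Fin K, ((S.U k).card : ℝ) ≤ μ * N

/-- Uplink communication load: total number of uplink bits, normalized by `N * T`. -/
noncomputable def uplinkLoad (S : Scheme K N T) : ℝ :=
  (∑ k : Fin K, (S.upLen k : ℝ)) / ((N : ℝ) * T)

/-- Downlink communication load: number of bits of the downlink message, normalized by `N * T`. -/
noncomputable def downlinkLoad (S : Scheme K N T) : ℝ :=
  (S.downLen : ℝ) / ((N : ℝ) * T)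

end Scheme

/-- The value at `x` of the lower convex envelope of a set `P` of points in the plane: the smallest
height above `x` of a point of the convex hull of `P`. -/
noncomputable def lowerConvexEnvelope (P : Set (ℝ × ℝ)) (x : ℝ) : ℝ :=
  sInf {y : ℝ | (x, y) ∈ convexHull ℝ P}

/-- The points `(t, f t)` for `t = 1/K, 2/K, …, 1`. -/
def gridPoints (K : ℕ) (f : ℝ → ℝ) : Set (ℝ × ℝ) :=
  {p | ∃ j ∈ Finset.Icc 1 K, p = ((j : ℝ) / K, f ((j : ℝ) / K))}

/-- The coded uplink load: the lower convex envelope of the points `(t, 1/t - 1)`. -/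
noncomputable def codedUplinkLoad (K : ℕ) (μ : ℝ) : ℝ :=
  lowerConvexEnvelope (gridPoints K (fun t => 1 / t - 1)) μ

/-- The coded downlink load: the lower convex envelope of the points
`(t, tK/(tK+1) * (1/t - 1))`. -/
noncomputable def codedDownlinkLoad (K : ℕ) (μ : ℝ) : ℝ :=
  lowerConvexEnvelope (gridPoints K (fun t => t * K / (t * K + 1) * (1 / t - 1))) μ

end WirelessComputing

/-!
The proof counts messages, with worst-case counts in place of entropies. As the intermediate values
are unconstrained, the scheme has to work for every array `v` of values. For a set `S` of users,
consider the arrays that agree with a given one except at the entries `(q, n)` with `q ∈ S` and with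
all holders of the file `n` in `S` (`cylinder`). The number of messages on this cylinder is bounded
below by induction on `S`.

Let `k ∈ S`, and fix the columns stored by `k`. The message then determines the row of `k`, whose
entries in the columns held only by `S \ {k}` are still free, and once they are fixed too, the
cylinder of `S \ {k}` remains. So the number of messages is at least the number of choices for these
entries times the minimum for `S \ {k}` (`pow_mul_le_ncard_image`).

* Downlink: averaging the logarithms of these bounds over `k ∈ S`, a file with `j` holders
  contributes `T * (|S| - j) / (j + 1)` bits (`log_ncard_ge_of_decodable`).
* Uplink: fixing the columns stored by `k` also fixes the message of `k`. Hence the set `A` of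
  message tuples satisfies `|A| ≥ |A k| * m k`, where `A k` is the set of messages of `k` and `m k`
  the bound above. With `|A| ≤ ∏ k ∈ S, |A k|`, this gives `|A| ^ (|S| - 1) ≥ ∏ k ∈ S, m k`, and a
  file with `j` holders contributes `T * (|S| - j) / j` bits (`log_ncard_ge_of_decodable_pi`).

For the set of all users, the loads are thus at least averages over the files of the heights of the
grid points at `j / K`. Every file has a holder, and the average of `j / K` is at most `μ` by the
storage constraint, so `lowerConvexEnvelope_gridPoints_le` concludes.
-/

namespace WirelessComputing

open Finset

theorem natCast_ncard_pos {β : Type*} [Finite β] {A : Set β} (hA : A.Nonempty) :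
    (0 : ℝ) < A.ncard :=
  Nat.cast_pos.mpr ((Set.ncard_pos (Set.toFinite _)).mpr hA)

/-! ### Counting the values of decodable messages -/

section Counting

variable {κ ν α M : Type*}

/-- The arrays that agree with `v` except possibly at the positions `(q, n)` for which the user `q`
and all holders of the file `n` (the users in `H n`) belong to `S`. -/
def cylinder (H : ν → Finset κ) (S : Finset κ) (v : κ → ν → α) : Set (κ → ν → α) :=
  {v' | ∀ q n, ¬(q ∈ S ∧ H n ⊆ S) → v' q n = v q n}

/-- A message `f v` is decodable if every user `k` can compute its row `v k` from the message and
the columns that it holds. -/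
def Decodable (H : ν → Finset κ) (f : (κ → ν → α) → M) : Prop :=
  ∀ v v' k, f v = f v' → (∀ q n, k ∈ H n → v q n = v' q n) → v k = v' k

theorem self_mem_cylinder (H : ν → Finset κ) (S : Finset κ) (v : κ → ν → α) :
    v ∈ cylinder H S v := fun _ _ _ => rfl

/-- If a decodable message depends only on the columns with a holder, then every column has a holder:
an unheld column could be changed without any effect on the message or on the held columns. -/
theorem exists_holder [Nonempty κ] [Nontrivial α] {H : ν → Finset κ} {f : (κ → ν → α) → M}
    (hf : Decodable H f)
    (hloc : ∀ v v' : κ → ν → α, (∀ q n, (H n).Nonempty → v q n = v' q n) → f v = f v') (n : ν) :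
    (H n).Nonempty := by
  classical
  by_contra hn
  obtain ⟨a, b, hab⟩ := exists_pair_ne α
  obtain ⟨k⟩ := ‹Nonempty κ›
  have key : ∀ q m, (H m).Nonempty →
      (fun _ _ => a : κ → ν → α) q m = (fun _ m => if m = n then b else a : κ → ν → α) q m := by
    intro q m hm
    have : m ≠ n := by rintro rfl; exact hn hm
    simp [this]
  have := congrFun (hf _ _ k (hloc _ _ key) (fun q m hm => key q m ⟨k, hm⟩)) n
  simp at this
  exact hab this

variable [DecidableEq κ] [Fintype ν]

/-- Double counting: a column held by `H n ⊆ S` is held only by `S \ {k}` for the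
`|S| - |H n|` users `k` of `S \ H n`. -/
theorem sum_sum_erase (H : ν → Finset κ) (S : Finset κ) (g : ν → ℝ) :
    ∑ k ∈ S, ∑ n with H n ⊆ S.erase k, g n =
      ∑ n with H n ⊆ S, ((#S : ℝ) - #(H n)) * g n := by
  simp_rw [sum_filter]
  rw [sum_comm]
  refine sum_congr rfl fun n _ => ?_
  split_ifs with h
  · have : ∀ k, H n ⊆ S.erase k ↔ k ∉ H n := fun k => by
      simp [subset_erase, h]
    simp_rw [this]
    rw [← sum_filter, sum_const, ← sdiff_eq_filter, card_sdiff_of_subset h, nsmul_eq_mul,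
      Nat.cast_sub (card_le_card h)]
  · refine sum_eq_zero fun k _ => if_neg fun hk => h (hk.trans (erase_subset _ _))

/-- If the weights `c s j` satisfy `d * c s j = (s - j) * (1 + c (s - 1) j)`, then the lower bounds that
the users `k ∈ S` give by revealing their row add up to `d` times the bound for `S`. The downlink
uses `c s j = (s - j) / (j + 1)` and `d = s`, the uplink `c s j = (s - j) / j` and `d = s - 1`. -/
theorem sum_erase_column_bounds {H : ν → Finset κ} {S : Finset κ} {L : ℝ} (c : ℕ → ℕ → ℝ)
    (d : ℝ) (hc : ∀ n, H n ⊆ S →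
      d * c #S #(H n) = ((#S : ℝ) - #(H n)) * (1 + c (#S - 1) #(H n))) :
    ∑ k ∈ S, (L * #{n | H n ⊆ S.erase k} + L * ∑ n with H n ⊆ S.erase k, c (#S - 1) #(H n)) =
      d * (L * ∑ n with H n ⊆ S, c #S #(H n)) := by
  have h1 : ∀ k, L * #{n | H n ⊆ S.erase k} + L * ∑ n with H n ⊆ S.erase k, c (#S - 1) #(H n) =
      L * ∑ n with H n ⊆ S.erase k, (1 + c (#S - 1) #(H n)) := fun k => by
    rw [sum_add_distrib, sum_const, nsmul_eq_mul, mul_one, mul_add]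
  simp_rw [h1]
  rw [← mul_sum, sum_sum_erase, mul_left_comm, mul_sum _ _ d]
  congr 1
  exact sum_congr rfl fun n hn => (hc n (mem_filter.mp hn).2).symm

variable [Fintype κ] [Fintype α]

/-- Once the columns held by `k` are fixed, the message determines the row of `k`. Each of the
possible values of the entries of this row in columns held only by `S \ {k}` leaves at least `m`
messages, and these are different for different values. -/
theorem pow_mul_le_ncard_image [Finite M] {H : ν → Finset κ} {f : (κ → ν → α) → M}
    (hf : Decodable H f) {S : Finset κ} {k : κ} (hk : k ∈ S) {m : ℝ}
    (hm : ∀ v, m ≤ ((f '' cylinder H (S.erase k) v).ncard : ℝ)) (v : κ → ν → α) :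
    (Fintype.card α : ℝ) ^ #{n | H n ⊆ S.erase k} * m ≤
      ((f '' {v' ∈ cylinder H S v | ∀ q n, k ∈ H n → v' q n = v q n}).ncard : ℝ) := by
  classical
  have := Fintype.ofFinite M
  let w : ({n // H n ⊆ S.erase k} → α) → κ → ν → α := fun z q n =>
    if h : q = k ∧ H n ⊆ S.erase k then z ⟨n, h.2⟩ else v q n
  have hcol : ∀ z v', v' ∈ cylinder H (S.erase k) (w z) → ∀ q n, k ∈ H n → v' q n = v q n := by
    intro z v' hv' q n hn
    have hns : ¬ H n ⊆ S.erase k := fun h => by simpa using h hn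
    rw [hv' q n (fun h => hns h.2)]
    simp [w, hns]
  have hrow : ∀ z v', v' ∈ cylinder H (S.erase k) (w z) → ∀ n : {n // H n ⊆ S.erase k},
      v' k n = z n := by
    intro z v' hv' n
    rw [hv' k n (by simp)]
    simp [w, n.2]
  have hcyl : ∀ z v', v' ∈ cylinder H (S.erase k) (w z) → v' ∈ cylinder H S v := by
    intro z v' hv' q n hqn
    have h1 : ¬(q ∈ S.erase k ∧ H n ⊆ S.erase k) := fun h =>
      hqn ⟨mem_of_mem_erase h.1, h.2.trans (erase_subset _ _)⟩
    have h2 : ¬(q = k ∧ H n ⊆ S.erase k) := fun h =>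
      hqn ⟨h.1 ▸ hk, h.2.trans (erase_subset _ _)⟩
    rw [hv' q n h1]
    simp [w, h2]
  have hdisj : ((univ : Finset ({n // H n ⊆ S.erase k} → α)) : Set _).PairwiseDisjoint
      (fun z => (f '' cylinder H (S.erase k) (w z)).toFinset) := by
    intro z _ z' _ hzz
    rw [Function.onFun, Finset.disjoint_left]
    intro x hx hx'
    simp only [Set.mem_toFinset] at hx hx'
    obtain ⟨u, hu, rfl⟩ := hx
    obtain ⟨u', hu', he⟩ := hx'
    have hkk := hf u' u k he (fun q n hn => by rw [hcol z' u' hu' q n hn, hcol z u hu q n hn])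
    exact hzz (funext fun n => by rw [← hrow z u hu n, ← hrow z' u' hu' n, hkk])
  have hsub : (univ.biUnion fun z => (f '' cylinder H (S.erase k) (w z)).toFinset) ⊆
      (f '' {v' ∈ cylinder H S v | ∀ q n, k ∈ H n → v' q n = v q n}).toFinset := by
    intro x hx
    simp only [mem_biUnion, mem_univ, true_and, Set.mem_toFinset] at hx ⊢
    obtain ⟨z, u, hu, rfl⟩ := hx
    exact ⟨u, ⟨hcyl z u hu, hcol z u hu⟩, rfl⟩
  have hcard := card_le_card hsub
  rw [card_biUnion hdisj] at hcard
  rw [Set.ncard_eq_toFinset_card']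
  refine le_trans ?_ (Nat.cast_le.mpr hcard)
  push_cast
  calc (Fintype.card α : ℝ) ^ #{n | H n ⊆ S.erase k} * m
      = ∑ _z : {n // H n ⊆ S.erase k} → α, m := by
        rw [sum_const, card_univ, Fintype.card_fun, Fintype.card_subtype, nsmul_eq_mul]
        push_cast
        rfl
    _ ≤ _ := sum_le_sum fun z _ => by
        rw [← Set.ncard_eq_toFinset_card']
        exact hm _

/-- The logarithmic form of `pow_mul_le_ncard_image`. -/
theorem add_le_log_ncard_image [Finite M] [Nonempty α] {H : ν → Finset κ}
    {f : (κ → ν → α) → M} (hf : Decodable H f) {S : Finset κ} {k : κ} (hk : k ∈ S) {b : ℝ}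
    (hb : ∀ v, b ≤ Real.log ((f '' cylinder H (S.erase k) v).ncard : ℝ)) (v : κ → ν → α) :
    Real.log (Fintype.card α) * #{n | H n ⊆ S.erase k} + b ≤
      Real.log
        ((f '' {v' ∈ cylinder H S v | ∀ q n, k ∈ H n → v' q n = v q n}).ncard : ℝ) := by
  have hα : (0 : ℝ) < Fintype.card α := by exact_mod_cast Fintype.card_pos
  have key := pow_mul_le_ncard_image hf hk (m := Real.exp b) (fun v => by
    have hpos : (0 : ℝ) < ((f '' cylinder H (S.erase k) v).ncard : ℝ) :=
      natCast_ncard_pos ⟨_, v, self_mem_cylinder _ _ _, rfl⟩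
    exact (Real.le_log_iff_exp_le hpos).mp (hb v)) v
  have h := Real.log_le_log (by positivity) key
  rwa [Real.log_mul (by positivity) (by positivity), Real.log_pow, Real.log_exp, mul_comm] at h

/-- The number of values of a decodable message. For `k ∈ S` the message reveals the row of `k`
and leaves the system of the users `S \ {k}`; the bound is the average over `k`. -/
theorem log_ncard_ge_of_decodable [Finite M] [Nonempty α] {H : ν → Finset κ}
    {f : (κ → ν → α) → M} (hf : Decodable H f) (S : Finset κ) (v : κ → ν → α) :
    Real.log (Fintype.card α) * ∑ n with H n ⊆ S, ((#S : ℝ) - #(H n)) / (#(H n) + 1) ≤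
      Real.log ((f '' cylinder H S v).ncard : ℝ) := by
  induction hs : #S generalizing S v with
  | zero =>
    obtain rfl := card_eq_zero.mp hs
    rw [sum_eq_zero, mul_zero]
    · exact Real.log_natCast_nonneg _
    · intro n hn
      simp [subset_empty.mp (mem_filter.mp hn).2]
  | succ s ih =>
    have hstep : ∀ k ∈ S, Real.log (Fintype.card α) * #{n | H n ⊆ S.erase k} +
        Real.log (Fintype.card α) *
          ∑ n with H n ⊆ S.erase k, (((#S - 1 : ℕ) : ℝ) - #(H n)) / (#(H n) + 1) ≤
        Real.log ((f '' cylinder H S v).ncard : ℝ) := fun k hk => by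
      refine (add_le_log_ncard_image hf hk (fun v => ?_) v).trans ?_
      · rw [hs]
        exact ih (S.erase k) v (by rw [card_erase_of_mem hk, hs]; rfl)
      · refine Real.log_le_log ?_ ?_
        · exact natCast_ncard_pos ⟨_, v, ⟨self_mem_cylinder _ _ _, fun _ _ _ => rfl⟩, rfl⟩
        · exact Nat.cast_le.mpr
            (Set.ncard_le_ncard (Set.image_mono (Set.sep_subset _ _)) (Set.toFinite _))
    have hsum := sum_le_sum hstep
    rw [sum_erase_column_bounds (fun s j => ((s : ℝ) - j) / (j + 1)) (#S : ℝ) (fun n _ => by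
      simp only [hs]
      push_cast
      field_simp
      ring), sum_const, nsmul_eq_mul] at hsum
    have hS : (0 : ℝ) < #S := by rw [hs]; positivity
    have := le_of_mul_le_mul_left hsum hS
    rwa [hs] at this

/-- A set of tuples is at most as large as the product of its projections. -/
theorem ncard_le_prod_ncard {W : κ → Type*} [∀ k, Finite (W k)] (A : Set (∀ k, W k)) :
    A.ncard ≤ ∏ k, ((fun x : ∀ k, W k => x k) '' A).ncard := by
  classical
  have := fun k => Fintype.ofFinite (W k)
  have h : A ⊆ (Fintype.piFinset fun k => ((fun x : ∀ k, W k => x k) '' A).toFinset :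
      Finset (∀ k, W k)) := by
    intro x hx
    simp only [mem_coe, Fintype.mem_piFinset, Set.mem_toFinset]
    exact fun k => ⟨x, hx, rfl⟩
  refine (Set.ncard_le_ncard h (Set.toFinite _)).trans ?_
  rw [Set.ncard_coe_finset, Fintype.card_piFinset]
  simp_rw [Set.ncard_eq_toFinset_card']
  exact le_rfl

/-- A set all of whose fibres under `p` have at least `m` elements has at least `m` times as many
elements as its image. -/
theorem ncard_image_mul_le {β γ : Type*} [Finite β] (A : Set β) (p : β → γ)
    {m : ℝ} (hm : ∀ a ∈ A, m ≤ ({x ∈ A | p x = p a}.ncard : ℝ)) :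
    ((p '' A).ncard : ℝ) * m ≤ A.ncard := by
  classical
  have := Fintype.ofFinite β
  have h := card_eq_sum_card_image p A.toFinset
  rw [Set.ncard_eq_toFinset_card' A, h, Set.ncard_eq_toFinset_card' (p '' A), Set.toFinset_image,
    ← nsmul_eq_mul, ← sum_const]
  push_cast
  refine sum_le_sum fun y hy => ?_
  obtain ⟨a, ha, rfl⟩ := mem_image.mp hy
  refine (hm a (Set.mem_toFinset.mp ha)).trans (le_of_eq ?_)
  rw [Set.ncard_eq_toFinset_card']
  congr 2
  ext x
  simp

/-- The number of values of a decodable tuple of messages, the `k`-th of which depends only on the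
columns held by `k`. Let `A` be the set of values of the tuple, `A k` that of the `k`-th message,
and `m k` the least number of values of the tuple once the `k`-th message is given. The estimate
combines `|A| ≤ ∏ k ∈ S, |A k|` with `|A k| * m k ≤ |A|`, which together give
`∏ k ∈ S, m k ≤ |A| ^ (|S| - 1)`. -/
theorem log_ncard_ge_of_decodable_pi [Nonempty α] {W : κ → Type*} [∀ k, Finite (W k)]
    {H : ν → Finset κ} (hH : ∀ n, (H n).Nonempty) {f : (κ → ν → α) → ∀ k, W k}
    (hf : Decodable H f)
    (hloc : ∀ k v v', (∀ q n, k ∈ H n → v q n = v' q n) → f v k = f v' k)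
    (S : Finset κ) (v : κ → ν → α) :
    Real.log (Fintype.card α) * ∑ n with H n ⊆ S, ((#S : ℝ) - #(H n)) / #(H n) ≤
      Real.log ((f '' cylinder H S v).ncard : ℝ) := by
  induction hs : #S generalizing S v with
  | zero =>
    obtain rfl := card_eq_zero.mp hs
    rw [sum_eq_zero, mul_zero]
    · exact Real.log_natCast_nonneg _
    · intro n hn
      simp [subset_empty.mp (mem_filter.mp hn).2]
  | succ s ih =>
    set A := f '' cylinder H S v with hA
    let P : κ → ℝ := fun k => (((fun x : ∀ k, W k => x k) '' A).ncard : ℝ)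
    have hAne : A.Nonempty := ⟨_, v, self_mem_cylinder _ _ _, rfl⟩
    have hApos : (0 : ℝ) < A.ncard := natCast_ncard_pos hAne
    have hPpos : ∀ k, 0 < P k := fun k => natCast_ncard_pos (hAne.image _)
    have hstep : ∀ k ∈ S, Real.log (Fintype.card α) * #{n | H n ⊆ S.erase k} +
        Real.log (Fintype.card α) *
          ∑ n with H n ⊆ S.erase k, (((#S - 1 : ℕ) : ℝ) - #(H n)) / #(H n) ≤
        Real.log (A.ncard : ℝ) - Real.log (P k) := fun k hk => by
      set e := Real.log (Fintype.card α) * #{n | H n ⊆ S.erase k} +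
        Real.log (Fintype.card α) *
          ∑ n with H n ⊆ S.erase k, (((#S - 1 : ℕ) : ℝ) - #(H n)) / #(H n) with he
      have hfib : ∀ a ∈ A, Real.exp e ≤ ({x ∈ A | x k = a k}.ncard : ℝ) := by
        rintro _ ⟨u, hu, rfl⟩
        -- Fixing the columns held by `k` fixes its message.
        have hsub : f '' {v' ∈ cylinder H S u | ∀ q n, k ∈ H n → v' q n = u q n} ⊆
            {x ∈ A | x k = f u k} := by
          rintro _ ⟨u', ⟨hu', hk'⟩, rfl⟩
          exact ⟨⟨u', fun q n h => (hu' q n h).trans (hu q n h), rfl⟩, hloc k _ _ hk'⟩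
        have hlog := add_le_log_ncard_image hf hk (fun v => ih (S.erase k) v
          (by rw [card_erase_of_mem hk, hs]; rfl)) u
        have hpos : (0 : ℝ) <
            ((f '' {v' ∈ cylinder H S u | ∀ q n, k ∈ H n → v' q n = u q n}).ncard : ℝ) :=
          natCast_ncard_pos ⟨_, u, ⟨self_mem_cylinder _ _ _, fun _ _ _ => rfl⟩, rfl⟩
        have h1 := (Real.le_log_iff_exp_le hpos).mp hlog
        rw [he, hs]
        exact h1.trans (by exact_mod_cast Set.ncard_le_ncard hsub (Set.toFinite _))
      have h2 := Real.log_le_log (mul_pos (hPpos k) (Real.exp_pos e))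
        (ncard_image_mul_le A (fun x : ∀ k, W k => x k) hfib)
      rw [Real.log_mul (hPpos k).ne' (Real.exp_pos e).ne', Real.log_exp] at h2
      linarith
    have hprod : Real.log (A.ncard : ℝ) ≤ ∑ k ∈ S, Real.log (P k) := by
      have h1 : (A.ncard : ℝ) ≤ ∏ k, P k := by
        have := (Nat.cast_le (α := ℝ)).mpr (ncard_le_prod_ncard A)
        rwa [Nat.cast_prod] at this
      have h2 : ∏ k, P k = ∏ k ∈ S, P k := by
        symm
        refine prod_subset (subset_univ _) fun k _ hk => ?_
        -- A user outside `S` only holds columns that are constant on the cylinder.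
        have : (fun x : ∀ k, W k => x k) '' A = {f v k} := by
          refine Set.eq_singleton_iff_unique_mem.mpr
            ⟨⟨_, ⟨v, self_mem_cylinder _ _ _, rfl⟩, rfl⟩, ?_⟩
          rintro _ ⟨_, ⟨u, hu, rfl⟩, rfl⟩
          exact hloc k _ _ fun q n hn => hu q n fun h => hk (h.2 hn)
        simp only [P, this, Set.ncard_singleton, Nat.cast_one]
      rw [← Real.log_prod fun k _ => (hPpos k).ne', ← h2]
      exact Real.log_le_log hApos h1
    rcases Nat.eq_zero_or_pos s with rfl | hs0
    · -- With a single user, every relevant column is held by exactly this user.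
      rw [sum_eq_zero, mul_zero]
      · exact Real.log_natCast_nonneg _
      · intro n hn
        have h1 := card_le_card (mem_filter.mp hn).2
        have h2 := (hH n).card_pos
        have : #(H n) = 1 := by omega
        simp [this]
    · have hsum := sum_le_sum hstep
      rw [sum_erase_column_bounds (fun s j => ((s : ℝ) - j) / j) (s : ℝ) (fun n _ => by
        have : (0 : ℝ) < #(H n) := by exact_mod_cast (hH n).card_pos
        simp only [hs]
        push_cast
        field_simp
        ring), sum_sub_distrib, sum_const, nsmul_eq_mul, hs] at hsum
      have hS : (0 : ℝ) < s := by exact_mod_cast hs0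
      refine le_of_mul_le_mul_left (hsum.trans ?_) hS
      push_cast at *
      linarith

end Counting

/-! ### The lower convex envelope -/

/-- An average of grid points to the left of `μ` lies above the envelope at `μ`: a convex
combination with `(1, 0)` moves it to the abscissa `μ` without raising it. -/
theorem lowerConvexEnvelope_gridPoints_le {K N : ℕ} (hK : 0 < K) (hN : 0 < N) {μ : ℝ}
    (hμ : μ ≤ 1) {f : ℝ → ℝ} (hf : ∀ t, 0 < t → t ≤ 1 → 0 ≤ f t) (hf1 : f 1 = 0)
    {j : Fin N → ℕ} (hj : ∀ n, 1 ≤ j n) (hjK : ∀ n, j n ≤ K)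
    (hsum : ∑ n, (j n : ℝ) ≤ μ * N * K) :
    lowerConvexEnvelope (gridPoints K f) μ ≤ (∑ n, f (j n / K)) / N := by
  have hK' : (0 : ℝ) < K := by exact_mod_cast hK
  have hN' : (0 : ℝ) < N := by exact_mod_cast hN
  have hnonneg : convexHull ℝ (gridPoints K f) ⊆ {p : ℝ × ℝ | 0 ≤ p.2} := by
    refine convexHull_min ?_ ?_
    · rintro _ ⟨i, hi, rfl⟩
      obtain ⟨h1, h2⟩ := mem_Icc.mp hi
      have h1' : (0 : ℝ) < i := by exact_mod_cast h1
      have h2' : (i : ℝ) ≤ K := by exact_mod_cast h2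
      exact hf _ (by positivity) ((div_le_one hK').mpr h2')
    · intro p hp q hq a b ha hb _
      simp only [Set.mem_ofPred_eq, Prod.snd_add, Prod.smul_snd, smul_eq_mul] at *
      positivity
  have hbdd : BddBelow {y : ℝ | (μ, y) ∈ convexHull ℝ (gridPoints K f)} :=
    ⟨0, fun y hy => hnonneg hy⟩
  set x := (∑ n, (j n : ℝ)) / (N * K) with hx
  set y := (∑ n, f (j n / K)) / N with hy
  have hxμ : x ≤ μ := by
    rw [hx, div_le_iff₀ (by positivity)]
    linarith
  have hmem : (x, y) ∈ convexHull ℝ (gridPoints K f) := by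
    have h := (convex_convexHull ℝ (gridPoints K f)).sum_mem (t := univ)
      (w := fun _ : Fin N => (1 : ℝ) / N) (z := fun n => ((j n : ℝ) / K, f (j n / K)))
      (fun _ _ => by positivity) (by simp [hN'.ne'])
      (fun n _ => subset_convexHull ℝ _ ⟨j n, mem_Icc.mpr ⟨hj n, hjK n⟩, rfl⟩)
    convert h using 1
    ext
    · simp only [Prod.fst_sum, Prod.smul_fst, smul_eq_mul]
      rw [← mul_sum, ← sum_div, hx]
      field_simp
    · simp only [Prod.snd_sum, Prod.smul_snd, smul_eq_mul]
      rw [← mul_sum, hy]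
      field_simp
  have hy0 : 0 ≤ y := hnonneg hmem
  have hone : ((1 : ℝ), (0 : ℝ)) ∈ convexHull ℝ (gridPoints K f) :=
    subset_convexHull ℝ _ ⟨K, mem_Icc.mpr ⟨hK, le_rfl⟩, by rw [div_self hK'.ne', hf1]⟩
  rcases hxμ.eq_or_lt with h | h
  · exact csInf_le hbdd (by rwa [Set.mem_ofPred_eq, ← h])
  · have hx1 : 0 < 1 - x := by linarith
    have hcomb := convex_convexHull ℝ (gridPoints K f) hmem hone
      (a := (1 - μ) / (1 - x)) (b := (μ - x) / (1 - x))
      (div_nonneg (by linarith) hx1.le) (div_nonneg (by linarith) hx1.le)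
      (by field_simp; ring)
    have heq : ((1 - μ) / (1 - x)) • (x, y) + ((μ - x) / (1 - x)) • ((1 : ℝ), (0 : ℝ)) =
        (μ, (1 - μ) / (1 - x) * y) := by
      ext
      · simp only [Prod.fst_add, Prod.smul_fst, smul_eq_mul]
        field_simp
        ring
      · simp
    rw [heq] at hcomb
    refine (csInf_le hbdd hcomb).trans (mul_le_of_le_one_left hy0 ?_)
    rw [div_le_one hx1]
    linarith

/-! ### Bounds on the message lengths of a scheme -/

namespace Scheme

variable {K N T : ℕ}

/-- The users that store the file `n`. -/
def holders (S : Scheme K N T) (n : Fin N) : Finset (Fin K) :=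
  {k | n ∈ S.U k}

theorem mem_holders {S : Scheme K N T} {n : Fin N} {k : Fin K} :
    k ∈ S.holders n ↔ n ∈ S.U k := by
  simp [holders]

theorem sum_card_holders (S : Scheme K N T) :
    ∑ n, #(S.holders n) = ∑ k, #(S.U k) := by
  have := sum_card_bipartiteAbove_eq_sum_card_bipartiteBelow (s := (univ : Finset (Fin N)))
    (t := (univ : Finset (Fin K))) (fun n k => n ∈ S.U k)
  simpa [bipartiteAbove, bipartiteBelow, holders] using this

theorem localValues_congr (S : Scheme K N T) {v v' : Fin K → Fin N → Bits T} {k : Fin K}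
    (h : ∀ q n, k ∈ S.holders n → v q n = v' q n) :
    S.localValues v k = S.localValues v' k := by
  funext q n
  exact h q n (mem_holders.mpr n.2)

theorem Accomplishes.decodable_downlink {S : Scheme K N T} {A : Application K N T}
    (hS : S.Accomplishes A) (hA : A.Unconstrained) : Decodable S.holders S.downlink := by
  intro v v' k hX hloc
  obtain ⟨w, rfl⟩ := hA v
  obtain ⟨w', rfl⟩ := hA v'
  rw [← hS w k, ← hS w' k, recovered, recovered, hX, localValues_congr S hloc]

/-- The downlink message is a function of the uplink messages, so these are decodable as well. -/
theorem Accomplishes.decodable_uplink {S : Scheme K N T} {A : Application K N T}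
    (hS : S.Accomplishes A) (hA : A.Unconstrained) : Decodable S.holders S.uplink :=
  fun v v' k hW => hS.decodable_downlink hA v v' k (congrArg S.ρ hW)

theorem card_bits (n : ℕ) : Fintype.card (Bits n) = 2 ^ n := by
  simp [Bits, ZMod.card]

theorem log_card_bits (n : ℕ) : Real.log (Fintype.card (Bits n)) = n * Real.log 2 := by
  rw [card_bits]
  push_cast
  rw [Real.log_pow]

theorem uplink_congr (S : Scheme K N T) (k : Fin K) (v v' : Fin K → Fin N → Bits T)
    (h : ∀ q n, k ∈ S.holders n → v q n = v' q n) : S.uplink v k = S.uplink v' k := by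
  rw [uplink, uplink, localValues_congr S h]

theorem Accomplishes.holders_nonempty {S : Scheme K N T} {A : Application K N T} (hK : 0 < K)
    (hT : 0 < T) (hS : S.Accomplishes A) (hA : A.Unconstrained) (n : Fin N) :
    (S.holders n).Nonempty := by
  have : NeZero K := ⟨hK.ne'⟩
  have : NeZero T := ⟨hT.ne'⟩
  refine exists_holder (hS.decodable_uplink hA) (fun v v' h => ?_) n
  exact funext fun k => S.uplink_congr k v v' fun q m hm => h q m ⟨k, hm⟩

theorem Accomplishes.sum_upLen_ge {S : Scheme K N T} {A : Application K N T} (hK : 0 < K)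
    (hT : 0 < T) (hS : S.Accomplishes A) (hA : A.Unconstrained) :
    (T : ℝ) * ∑ n, ((K : ℝ) - #(S.holders n)) / #(S.holders n) ≤ ∑ k, (S.upLen k : ℝ) := by
  have h := log_ncard_ge_of_decodable_pi (hS.holders_nonempty hK hT hA) (hS.decodable_uplink hA)
    S.uplink_congr univ 0
  have hle : ((S.uplink '' cylinder S.holders univ 0).ncard : ℝ) ≤ 2 ^ ∑ k, S.upLen k := by
    have h1 := Set.ncard_le_card (S.uplink '' cylinder S.holders univ 0)
    rw [Nat.card_eq_fintype_card, Fintype.card_pi] at h1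
    simp_rw [card_bits] at h1
    rw [prod_pow_eq_pow_sum] at h1
    exact_mod_cast h1
  have hpos : (0 : ℝ) < ((S.uplink '' cylinder S.holders univ 0).ncard : ℝ) :=
    natCast_ncard_pos ⟨_, 0, self_mem_cylinder _ _ _, rfl⟩
  have h2 := h.trans (Real.log_le_log hpos hle)
  simp only [subset_univ, filter_true, card_univ, Fintype.card_fin] at h2
  rw [log_card_bits, Real.log_pow, mul_right_comm] at h2
  have := le_of_mul_le_mul_right h2 (Real.log_pos one_lt_two)
  exact_mod_cast this

theorem Accomplishes.downLen_ge {S : Scheme K N T} {A : Application K N T}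
    (hS : S.Accomplishes A) (hA : A.Unconstrained) :
    (T : ℝ) * ∑ n, ((K : ℝ) - #(S.holders n)) / (#(S.holders n) + 1) ≤ S.downLen := by
  have h := log_ncard_ge_of_decodable (hS.decodable_downlink hA) univ 0
  have hle : ((S.downlink '' cylinder S.holders univ 0).ncard : ℝ) ≤ 2 ^ S.downLen := by
    have h1 := Set.ncard_le_card (S.downlink '' cylinder S.holders univ 0)
    rw [Nat.card_eq_fintype_card, card_bits] at h1
    exact_mod_cast h1
  have hpos : (0 : ℝ) < ((S.downlink '' cylinder S.holders univ 0).ncard : ℝ) :=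
    natCast_ncard_pos ⟨_, 0, self_mem_cylinder _ _ _, rfl⟩
  have h2 := h.trans (Real.log_le_log hpos hle)
  simp only [subset_univ, filter_true, card_univ, Fintype.card_fin] at h2
  rw [log_card_bits, Real.log_pow, mul_right_comm] at h2
  exact le_of_mul_le_mul_right h2 (Real.log_pos one_lt_two)

theorem FitsStorage.sum_card_holders_le {S : Scheme K N T} {μ : ℝ} (hU : S.FitsStorage μ) :
    ∑ n, (#(S.holders n) : ℝ) ≤ μ * N * K := by
  have h : ∑ n, (#(S.holders n) : ℝ) = ∑ k, (#(S.U k) : ℝ) := by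
    exact_mod_cast S.sum_card_holders
  rw [h]
  refine (sum_le_sum fun k _ => hU k).trans (le_of_eq ?_)
  simp [mul_comm]

end Scheme

end WirelessComputing

theorem theorem3 {K N T : ℕ} (hK : 0 < K) (hN : 0 < N) (hT : 0 < T)
    (μ : ℝ) (hμ : 1 / (K : ℝ) ≤ μ) (hμ' : μ ≤ 1)
    (A : WirelessComputing.Application K N T) (hA : A.Unconstrained)
    (S : WirelessComputing.Scheme K N T) (hU : S.FitsStorage μ) (hS : S.Accomplishes A) :
    WirelessComputing.codedUplinkLoad K μ ≤ S.uplinkLoad ∧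
      WirelessComputing.codedDownlinkLoad K μ ≤ S.downlinkLoad := by
  have hK' : (0 : ℝ) < K := by exact_mod_cast hK
  have hN' : (0 : ℝ) < N := by exact_mod_cast hN
  have hT' : (0 : ℝ) < T := by exact_mod_cast hT
  have hne := hS.holders_nonempty hK hT hA
  have hj : ∀ n, 1 ≤ (S.holders n).card := fun n => (hne n).card_pos
  have hjK : ∀ n, (S.holders n).card ≤ K := fun n => by
    simpa using Finset.card_le_univ (S.holders n)
  have hj0 : ∀ n, (0 : ℝ) < (S.holders n).card := fun n => by exact_mod_cast hj n
  constructor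
  · refine (WirelessComputing.lowerConvexEnvelope_gridPoints_le hK hN hμ' (fun t h0 h1 => ?_)
      (by norm_num) hj hjK hU.sum_card_holders_le).trans ?_
    · rw [sub_nonneg, one_le_div h0]
      exact h1
    · rw [WirelessComputing.Scheme.uplinkLoad, div_le_div_iff₀ hN' (by positivity)]
      have h : ∑ n, (1 / (((S.holders n).card : ℝ) / K) - 1) =
          ∑ n, ((K : ℝ) - (S.holders n).card) / (S.holders n).card :=
        Finset.sum_congr rfl fun n _ => by
          have := hj0 n
          field_simp
      rw [h]
      nlinarith [hS.sum_upLen_ge hK hT hA]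
  · refine (WirelessComputing.lowerConvexEnvelope_gridPoints_le hK hN hμ' (fun t h0 h1 => ?_)
      (by norm_num) hj hjK hU.sum_card_holders_le).trans ?_
    · have : 0 ≤ 1 / t - 1 := by
        rw [sub_nonneg, one_le_div h0]
        exact h1
      positivity
    · rw [WirelessComputing.Scheme.downlinkLoad, div_le_div_iff₀ hN' (by positivity)]
      have h : ∑ n, (((S.holders n).card : ℝ) / K * K / (((S.holders n).card : ℝ) / K * K + 1) *
            (1 / (((S.holders n).card : ℝ) / K) - 1)) =
          ∑ n, ((K : ℝ) - (S.holders n).card) / ((S.holders n).card + 1) :=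
        Finset.sum_congr rfl fun n _ => by
          have := hj0 n
          field_simp
      rw [h]
      nlinarith [hS.downLen_ge hA]
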